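/- **Setting.** Fix $n,\ell,w,m\in\mathbb N$, a two-universal class $\mathcal F$ of hash functions $\{0,1\}^n\to\{0,1\}^\ell$ (a string of length $n'<n$ is padded with zeros before hashing), and a trapdoor claw-free function family with finitely many keys and trapdoors: every key $k$ gives a pair $f_{k,0},f_{k,1}:\{0,1\}^w\to\{0,1\}^m$; for the claw-free keys both functions are injective with the same image, for the injective keys both are injective with disjoint images; every such key has a trapdoor, with which claws $(x_0,x_1)$, $f_{k,0}(x_0)=f_{k,1}(x_1)$, respectively preimages, can be computed. (No computational hardness is needed.) Write $[\texttt{Comp},\texttt{Had}]_0=\texttt{Comp}$ and $[\texttt{Comp},\texttt{Had}]_1=\texttt{Had}$. **Protocol (device-independent Rand 1-2 OT$^\ell$), honest receiver with choice bit $c$.** In each of $n$ rounds $i$ the sender supplies a key $k_i$, which the receiver inputs into his component of the device, obtaining a string $c_i\in\{0,1\}^m$. The sender supplies a challenge type $CT_i\in\{\texttt a,\texttt b\}$, which is input into the component. If $CT_i=\texttt a$, the component returns a string $z_i\in\{0,1\}^{1+w}$. If $CT_i=\texttt b$, it returns $d_i\in\{0,1\}^w$; the sender supplies a basis question in $\{\texttt{Comp},\texttt{Had}\}$;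 the receiver tosses a fair coin and inputs as $y_i$ either that question or $[\texttt{Comp},\texttt{Had}]_c$; the component returns bits $b_i,h_i$. Let $I$ be the set of rounds in which $[\texttt{Comp},\texttt{Had}]_c$ was chosen by the coin. The sender then sends $T\in\{\texttt{Test},\texttt{Generate}\}^n$; the receiver sends $I$ and the component's outputs of all rounds $i\notin I$ with $T_i=\texttt{Test}$. The sender aborts ($Z=0$) or continues ($Z=1$), and in the latter case publishes trapdoors $t_i$, hash functions $f_0,f_1\in\mathcal F$ and bases $x_i$ for the rounds in $\widetilde I=\{i\in I: T_i=\texttt{Generate}\}$. The receiver computes the claws $(x_{i,0},x_{i,1})$ from $k_i,t_i,c_i$, sets $v_i=d_i\cdot(x_{i,0}\oplus x_{i,1})$, $w_i=v_i$ if $y_i=\texttt{Comp}$ and $w_i=0$ if $y_i=\texttt{Had}$, and outputs $Y=f_c\big((b\oplus w)|_{\widetilde I_c}\big)$, where $\widetilde I_c=\{i\in\widetilde I:x_i=[\texttt{Comp},\texttt{Had}]_c\}$. **Device and dishonest sender.** All systems are finite-dimensional. A dishonest sender $\widetilde S$ holds an arbitrary quantum system, including the other component of the device, in an arbitrary initial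 state, and produces each of his messages (including the decision to abort, which may depend on the receiver's message) by an arbitrary quantum instrument. The receiver's component has a fresh system in each round. Until the basis $y_i$ is input, the device may act on this system and on the sender's system by arbitrary joint operations (unlimited communication). Upon the input $y_i$, the component measures its own system with a POVM depending on $y_i$; the outcome $(b_i,h_i)$ is given to the receiver only, and the system is not used again. (The measurement basis and the resulting output are communicated only to the receiver, and the component behaves in the same way in every round, without memory of the bases and outcomes of earlier rounds.) **Proposition.** The protocol is perfectly receiver-secure. That is, for every such device, every dishonest sender $\widetilde S$ and every distribution of the choice bit $C$ (independent of the initial state), let $\rho^{Z=1}_{CY\widetilde S}$ be the ccq-state of $C$, the honest receiver's output $Y$ and the sender's final system, conditioned on the protocol not aborting (if $\Pr(Z=1)=0$ there is nothing to show). Then there are random variables $S_0',S_1'\in\{0,1\}^\ell$, i.e. an extension of $\rho^{Z=1}_{CY\widetilde S}$ to a state $\rho^{Z=1}_{CYS_0'S_1'\widetilde S}$ that is classical on $C,Y,S_0',S_1'$, such that $$\Pr[Y=S'_C]\ge 1\quad\text{and}\quad \Pr(Z=1)\,D\big(\rho^{Z=1}_{CS_0'S_1'\widetilde S},\ \rho^{Z=1}_C\otimes\rho^{Z=1}_{S_0'S_1'\widetilde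 S}\big)\le 0,$$ where $D(\rho,\sigma)=\tfrac12\operatorname{tr}|\rho-\sigma|$ is the trace distance. -/

import Mathlib

open scoped Kronecker MatrixOrder ComplexOrder

namespace ObliviousTransfer

/-! ### States, instruments and measurements on finite-dimensional systems

A finite-dimensional quantum system is given by a finite type `S` labelling an orthonormal basis;
its operators are the matrices `Matrix S S ℂ`. -/

/-- The partial trace over the second tensor factor. -/
noncomputable def traceRight {S B : Type} [Fintype B]
    (ρ : Matrix (S × B) (S × B) ℂ) : Matrix S S ℂ :=
  Matrix.of fun i j => ∑ b, ρ (i, b) (j, b)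

/-- The partial trace over the first tensor factor. -/
noncomputable def traceLeft {S B : Type} [Fintype S]
    (ρ : Matrix (S × B) (S × B) ℂ) : Matrix B B ℂ :=
  Matrix.of fun i j => ∑ s, ρ (s, i) (s, j)

/-- The trace distance `D(ρ, σ) = ½ tr |ρ - σ|`, where `|A|` is the positive square root of
`Aᴴ * A`. -/
noncomputable def traceDist {S : Type} [Fintype S] [DecidableEq S]
    (ρ σ : Matrix S S ℂ) : ℝ :=
  (1 / 2 : ℝ) * (Matrix.trace (CFC.abs (ρ - σ))).re

/-- A quantum instrument with classical outcomes in `O`, from the system `S` to the system `S'`,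
in Kraus form. -/
structure Instrument (O S S' : Type) [Fintype O] [Fintype S] [DecidableEq S] [Fintype S'] where
  /-- The number of Kraus operators of each outcome. -/
  rank : ℕ
  /-- The Kraus operators. -/
  kraus : O → Fin rank → Matrix S' S ℂ
  /-- The sum over all outcomes preserves the trace. -/
  complete : ∑ o, ∑ j, (kraus o j).conjTranspose * kraus o j = 1

namespace Instrument

variable {O S S' B : Type} [Fintype O] [Fintype S] [DecidableEq S] [Fintype S']

/-- The unnormalized state after the outcome `o`; its trace is the probability of `o`. -/
noncomputable def apply (Φ : Instrument O S S') (o : O) (ρ : Matrix S S ℂ) : Matrix S' S' ℂ :=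
  ∑ j, Φ.kraus o j * ρ * (Φ.kraus o j).conjTranspose

/-- The action of an instrument on `S` upon a joint state of `S` and `B`, leaving `B` alone. -/
noncomputable def applyLeft [Fintype B] [DecidableEq B] (Φ : Instrument O S S') (o : O)
    (ρ : Matrix (S × B) (S × B) ℂ) : Matrix (S' × B) (S' × B) ℂ :=
  ∑ j, (Φ.kraus o j ⊗ₖ (1 : Matrix B B ℂ)) * ρ *
    (Φ.kraus o j ⊗ₖ (1 : Matrix B B ℂ)).conjTranspose

end Instrument

/-- A measurement (POVM) of the system `B` with outcomes in `O`. -/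
structure Measurement (O B : Type) [Fintype O] [Fintype B] [DecidableEq B] where
  /-- The positive operator of each outcome. -/
  effect : O → Matrix B B ℂ
  posSemidef : ∀ o, (effect o).PosSemidef
  complete : ∑ o, effect o = 1

/-- Measure the system `B` of a joint state of `S` and `B`: the unnormalized state of `S` after
the outcome `o`. -/
noncomputable def Measurement.applyRight {O S B : Type} [Fintype O] [Fintype S] [DecidableEq S]
    [Fintype B] [DecidableEq B] (M : Measurement O B) (o : O)
    (ρ : Matrix (S × B) (S × B) ℂ) : Matrix S S ℂ :=
  traceRight (((1 : Matrix S S ℂ) ⊗ₖ M.effect o) * ρ)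

/-- The matrix `∑ x, |x⟩⟨x| ⊗ ρ x` of a cq-state. Here `ρ x` is the state of the quantum part
multiplied by the probability of `x`. -/
noncomputable def cqState {X S : Type} [Fintype X] [DecidableEq X]
    (ρ : X → Matrix S S ℂ) : Matrix (X × S) (X × S) ℂ :=
  ∑ x, Matrix.single x x (1 : ℂ) ⊗ₖ ρ x

/-! ### The ingredients of the protocol -/

/-- Bit strings of length `n`. -/
abbrev BitString (n : ℕ) : Type := Fin n → Bool

/-- The inner product modulo two of two bit strings. -/
def innerBit {w : ℕ} (d x : BitString w) : Bool :=
  decide (Odd (Finset.univ.filter fun j => (d j && x j) = true).card)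

/-- The string `s|_J` (the entries of `s` at the positions in `J`, in increasing order), padded
with zeros to length `n`. -/
def restrictPad {n : ℕ} (s : BitString n) (J : Finset (Fin n)) : BitString n :=
  fun j => if h : (j : ℕ) < J.card then s (J.orderEmbOfFin rfl ⟨j, h⟩) else false

/-- The two measurement bases. -/
inductive Basis
  | computational
  | hadamard
  deriving DecidableEq

instance : Fintype Basis where
  elems := {.computational, .hadamard}
  complete x := by cases x <;> simp

/-- `[Computational, Hadamard]_c`. -/
def Basis.ofBit : Bool → Basis
  | false => .computational
  | true => .hadamard

/-- The two challenge types. -/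
inductive Challenge
  | a
  | b
  deriving DecidableEq

instance : Fintype Challenge where
  elems := {.a, .b}
  complete x := by cases x <;> simp

/-- The two kinds of rounds. -/
inductive RoundUse
  | test
  | generate
  deriving DecidableEq

instance : Fintype RoundUse where
  elems := {.test, .generate}
  complete x := by cases x <;> simp

/-- The functions, keys and trapdoors of an extended trapdoor claw-free function family (at a
fixed security parameter). Every property of the functions and of the trapdoors is required, but
no computational hardness. The recovery maps are total: on a false trapdoor they return some
value. -/
structure TrapdoorFamily (Key Trap : Type) (w m : ℕ) where
  /-- The keys of claw-free pairs. -/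
  clawFreeKeys : Set Key
  /-- The keys of injective pairs. -/
  injectiveKeys : Set Key
  /-- The function pair of a key. -/
  f : Key → Bool → BitString w → BitString m
  /-- `t` is a trapdoor of `k`. -/
  IsTrapdoor : Key → Trap → Prop
  exists_trapdoor : ∀ k ∈ clawFreeKeys ∪ injectiveKeys, ∃ t, IsTrapdoor k t
  injective : ∀ k ∈ clawFreeKeys ∪ injectiveKeys, ∀ b, Function.Injective (f k b)
  range_eq : ∀ k ∈ clawFreeKeys, Set.range (f k false) = Set.range (f k true)
  disjoint_range : ∀ k ∈ injectiveKeys,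
    Disjoint (Set.range (f k false)) (Set.range (f k true))
  /-- Computing a claw with the help of a trapdoor. -/
  claw : Key → Trap → BitString m → BitString w × BitString w
  claw_eq : ∀ k ∈ clawFreeKeys, ∀ t, IsTrapdoor k t → ∀ x₀ x₁,
    f k false x₀ = f k true x₁ → claw k t (f k false x₀) = (x₀, x₁)
  /-- Inverting an injective pair with the help of a trapdoor. -/
  invert : Key → Trap → BitString m → Bool × BitString w
  invert_eq : ∀ k ∈ injectiveKeys, ∀ t, IsTrapdoor k t → ∀ b x,
    invert k t (f k b x) = (b, x)

/-- The public parameters of the device-independent Rand 1-2 OT^ℓ protocol with `n` rounds: a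
trapdoor family, and a two-universal class of hash functions from `n` bits to `ℓ` bits. -/
structure Parameters (Key Trap : Type) (n ℓ w m : ℕ) where
  family : TrapdoorFamily Key Trap w m
  hash : Finset (BitString n → BitString ℓ)
  hash_nonempty : hash.Nonempty
  two_universal : ∀ x x' : BitString n, x ≠ x' →
    ((hash.filter fun f => f x = f x').card : ℝ) / hash.card ≤ 1 / 2 ^ ℓ

/-! ### The transcript and the honest receiver -/

/-- What happens in a round after the challenge type has been sent. -/
inductive Response (w : ℕ)
  /-- Challenge `a`: the receiver's component returns the string `z`. -/
  | a (z : Bool × BitString w)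
  /-- Challenge `b`: the receiver's component returns `d`, the sender supplies the basis question
  `question`, the receiver decides by the fair coin `useChoice` whether to use the basis given by
  the choice bit instead, and the component returns the bits `ans` and `h`. -/
  | b (d : BitString w) (question : Basis) (useChoice ans h : Bool)

/-- Responses as a sum of products. -/
def Response.equiv (w : ℕ) : Response w ≃
    (Bool × BitString w) ⊕ (BitString w × Basis × Bool × Bool × Bool) where
  toFun
    | .a z => .inl z
    | .b d q u ans h => .inr (d, q, u, ans, h)
  invFun
    | .inl z => .a z
    | .inr (d, q, u, ans, h) => .b d q u ans h
  left_inv r := by cases r <;> rfl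
  right_inv r := by rcases r with z | ⟨d, q, u, ans, h⟩ <;> rfl

instance (w : ℕ) : Fintype (Response w) := Fintype.ofEquiv _ (Response.equiv w).symm

/-- The receiver's view of one round. -/
structure RoundRecord (Key : Type) (w m : ℕ) where
  /-- The key supplied by the sender for the receiver's component. -/
  key : Key
  /-- The first string returned by the receiver's component. -/
  commitment : BitString m
  response : Response w

/-- Round records as triples. -/
def RoundRecord.equiv (Key : Type) (w m : ℕ) :
    RoundRecord Key w m ≃ Key × BitString m × Response w where
  toFun r := (r.key, r.commitment, r.response)
  invFun r := ⟨r.1, r.2.1, r.2.2⟩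
  left_inv _ := rfl
  right_inv _ := rfl

instance (Key : Type) [Fintype Key] (w m : ℕ) : Fintype (RoundRecord Key w m) :=
  Fintype.ofEquiv _ (RoundRecord.equiv Key w m).symm

/-- The receiver's view of a run in which the protocol does not abort. The trapdoors and the
bases announced by the sender matter only for the rounds that are used to generate the output. -/
structure Transcript (Key Trap H : Type) (n w m : ℕ) where
  round : Fin n → RoundRecord Key w m
  use : Fin n → RoundUse
  trapdoor : Fin n → Trap
  hash₀ : H
  hash₁ : H
  bases : Fin n → Basis

/-- Transcripts as tuples. -/
def Transcript.equiv (Key Trap H : Type) (n w m : ℕ) :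
    Transcript Key Trap H n w m ≃ (Fin n → RoundRecord Key w m) × (Fin n → RoundUse) ×
      (Fin n → Trap) × H × H × (Fin n → Basis) where
  toFun t := (t.round, t.use, t.trapdoor, t.hash₀, t.hash₁, t.bases)
  invFun t := ⟨t.1, t.2.1, t.2.2.1, t.2.2.2.1, t.2.2.2.2.1, t.2.2.2.2.2⟩
  left_inv _ := rfl
  right_inv _ := rfl

instance (Key Trap H : Type) [Fintype Key] [Fintype Trap] [Fintype H] (n w m : ℕ) :
    Fintype (Transcript Key Trap H n w m) :=
  Fintype.ofEquiv _ (Transcript.equiv Key Trap H n w m).symm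

/-- The basis that the receiver with choice bit `c` inputs into the component. -/
def usedBasis (c : Bool) (question : Basis) (useChoice : Bool) : Basis :=
  if useChoice then Basis.ofBit c else question

namespace Response

variable {w : ℕ}

/-- Did the receiver use the basis given by the choice bit in this round? -/
def usesChoice : Response w → Bool
  | .a _ => false
  | .b _ _ u _ _ => u

/-- The answer bit of the component (only meaningful for challenge `b`). -/
def answer : Response w → Bool
  | .a _ => false
  | .b _ _ _ ans _ => ans

/-- The string `d` (only meaningful for challenge `b`). -/
def hadamardString : Response w → BitString w
  | .a _ => fun _ => false
  | .b d _ _ _ _ => d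

/-- The output of the component in the last part of the round: `z`, or `(d, b, h)`. -/
def output : Response w → (Bool × BitString w) ⊕ (BitString w × Bool × Bool)
  | .a z => .inl z
  | .b d _ _ ans h => .inr (d, ans, h)

end Response

/-- The message that the receiver sends for the testing: the set `I` of the rounds in which the
basis was given by the choice bit, and the outputs of all test rounds outside `I`. -/
structure TestMessage (n w m : ℕ) where
  choiceRounds : Finset (Fin n)
  published : Fin n →
    Option (BitString m × ((Bool × BitString w) ⊕ (BitString w × Bool × Bool)))

/-- The set `I`. -/
def choiceRounds {Key : Type} {n w m : ℕ} (r : Fin n → RoundRecord Key w m) :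
    Finset (Fin n) :=
  Finset.univ.filter fun i => (r i).response.usesChoice = true

/-- The honest receiver's message, given the test and generation rounds chosen by the sender. -/
def testMessage {Key : Type} {n w m : ℕ} (r : Fin n → RoundRecord Key w m)
    (use : Fin n → RoundUse) : TestMessage n w m where
  choiceRounds := choiceRounds r
  published i :=
    if use i = .test ∧ i ∉ choiceRounds r then
      some ((r i).commitment, (r i).response.output)
    else none

namespace Transcript

variable {Key Trap : Type} {n ℓ w m : ℕ} {P : Parameters Key Trap n ℓ w m}

/-- The set `Ĩ_c` of the generation rounds in `I` for which the announced basis is the one given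
by `c`. -/
def outputRounds (tr : Transcript Key Trap P.hash n w m) (c : Bool) : Finset (Fin n) :=
  (choiceRounds tr.round).filter fun i => tr.use i = .generate ∧ tr.bases i = Basis.ofBit c

/-- The bit `v^β_i = d · (x₀ ⊕ x₁)`, where `(x₀, x₁)` is the claw computed with the trapdoor. -/
def bellBit (tr : Transcript Key Trap P.hash n w m) (i : Fin n) : Bool :=
  let x := P.family.claw (tr.round i).key (tr.trapdoor i) (tr.round i).commitment
  innerBit (tr.round i).response.hadamardString fun j => xor (x.1 j) (x.2 j)

/-- The correction `w^β_i` in a round measured in the basis given by the choice bit `c`. -/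
def correction (tr : Transcript Key Trap P.hash n w m) (c : Bool) (i : Fin n) : Bool :=
  match Basis.ofBit c with
  | .hadamard => false
  | .computational => tr.bellBit i

/-- The output `f_c (b ⊕ w^β |_{Ĩ_c})` of the honest receiver with choice bit `c`. -/
def receiverOutput (tr : Transcript Key Trap P.hash n w m) (c : Bool) : BitString ℓ :=
  (if c then tr.hash₁ else tr.hash₀).1
    (restrictPad (fun i => xor (tr.round i).response.answer (tr.correction c i))
      (tr.outputRounds c))

end Transcript

/-! ### The device and the dishonest sender -/

section Experiment

variable {Key Trap : Type} [Fintype Key] [Fintype Trap]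
  {n ℓ w m : ℕ} (S B : Type) [Fintype S] [DecidableEq S] [Fintype B] [DecidableEq B]

/-- The behaviour of the device in a round. The system `S` is everything on the sender's side: the
sender's memory, the sender's component, and the quantum channel as far as the sender can reach it.
The system `B` is the receiver's component in one round; each round has a fresh one.

Until the measurement basis is input into the receiver's component, the device may apply any joint
operation to `S` and `B` (unlimited communication). From then on the receiver's component acts on
`B` alone, its outcome goes to the receiver only, and what is left of `B` is not used again: the
basis and the outcome are communicated to nobody but the receiver, and the rounds do not
influence one another through the receiver's component. -/
structure Device (Key : Type) (w m : ℕ) where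
  /-- Upon a key: set up the component for a new round and return a string to the receiver. -/
  commit : Key → Instrument (BitString m) S (S × B)
  /-- Upon challenge `a`: return the string `z`. -/
  answerA : Instrument (Bool × BitString w) (S × B) (S × B)
  /-- Upon challenge `b`: return the string `d`. -/
  answerB : Instrument (BitString w) (S × B) (S × B)
  /-- Upon a measurement basis: return the bits `b` and `h`. -/
  measure : Basis → Measurement (Bool × Bool) B

/-- A dishonest sender: an initial state, and for every message of the protocol an arbitrary
instrument whose outcome is the message. Everything the sender wants to remember is kept in `S`. -/
structure DishonestSender (P : Parameters Key Trap n ℓ w m) where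
  init : Matrix S S ℂ
  init_posSemidef : init.PosSemidef
  init_trace : init.trace = 1
  /-- The key for the receiver's component in each round. -/
  sendKey : Fin n → Instrument Key S S
  /-- The challenge type in each round. -/
  sendChallenge : Fin n → Instrument Challenge S S
  /-- The basis question in each round with challenge `b`. -/
  sendQuestion : Fin n → Instrument Basis S S
  /-- The choice of test and generation rounds. -/
  sendUses : Instrument (Fin n → RoundUse) S S
  /-- The decision, upon the receiver's message, whether to continue (`true`, that is `Z = 1`) or
  to abort (`false`). -/
  decide : TestMessage n w m → Instrument Bool S S
  /-- The published trapdoors. -/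
  sendTrapdoors : Instrument (Fin n → Trap) S S
  /-- The announced hash functions and bases. -/
  announce : Instrument (P.hash × P.hash × (Fin n → Basis)) S S

variable {S B} {P : Parameters Key Trap n ℓ w m}
  (𝒟 : Device S B Key w m) (𝒮 : DishonestSender S P)

/-- One round with the honest receiver with choice bit `c`: the unnormalized state on the sender's
side after the round, if the round has the record `r`. -/
noncomputable def roundState (c : Bool) (i : Fin n) (r : RoundRecord Key w m)
    (ρ : Matrix S S ℂ) : Matrix S S ℂ :=
  let ρ₁ := (𝒟.commit r.key).apply r.commitment ((𝒮.sendKey i).apply r.key ρ)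
  match r.response with
  | .a z => traceRight (𝒟.answerA.apply z ((𝒮.sendChallenge i).applyLeft .a ρ₁))
  | .b d question useChoice ans h =>
    let ρ₂ := 𝒟.answerB.apply d ((𝒮.sendChallenge i).applyLeft .b ρ₁)
    let ρ₃ := (𝒮.sendQuestion i).applyLeft question ρ₂
    (1 / 2 : ℂ) • (𝒟.measure (usedBasis c question useChoice)).applyRight (ans, h) ρ₃

/-- The unnormalized final state on the sender's side, if the receiver has choice bit `c`, the
protocol does not abort, and the run has the transcript `tr`. -/
noncomputable def finalState (c : Bool) (tr : Transcript Key Trap P.hash n w m) :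
    Matrix S S ℂ :=
  let ρ₁ := Fin.foldl n (fun ρ i => roundState 𝒟 𝒮 c i (tr.round i) ρ) 𝒮.init
  let ρ₂ := 𝒮.sendUses.apply tr.use ρ₁
  let ρ₃ := (𝒮.decide (testMessage tr.round tr.use)).apply true ρ₂
  let ρ₄ := 𝒮.sendTrapdoors.apply tr.trapdoor ρ₃
  𝒮.announce.apply (tr.hash₀, tr.hash₁, tr.bases) ρ₄

/-- The unnormalized ccq-state of the choice bit `C`, the receiver's output `Y` and the dishonest
sender, restricted to the event that the protocol does not abort, if `C` has the distribution
`p`. -/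
noncomputable def jointState (p : Bool → ℝ) (c : Bool) (y : BitString ℓ) : Matrix S S ℂ :=
  (p c : ℂ) • ∑ tr : Transcript Key Trap P.hash n w m,
    if tr.receiverOutput c = y then finalState 𝒟 𝒮 c tr else 0

/-- `Pr(Z = 1)`, the probability that the protocol does not abort. -/
noncomputable def probContinue (p : Bool → ℝ) : ℝ :=
  ∑ c, ∑ y, (jointState 𝒟 𝒮 p c y).trace.re

/-- The ccq-state `ρ^{Z=1}_{C Y S̃}` when the protocol does not abort. -/
noncomputable def realState (p : Bool → ℝ) (c : Bool) (y : BitString ℓ) : Matrix S S ℂ :=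
  ((probContinue 𝒟 𝒮 p)⁻¹ : ℂ) • jointState 𝒟 𝒮 p c y

end Experiment

/-- `ε`-receiver-security: for every device and every dishonest sender, for every distribution of
the choice bit, there are random variables `S₀'`, `S₁'`, that is a joint state `ρ` of
`C, Y, S₀', S₁'` and the sender which extends the real one, such that `Pr[Y = S'_C] ≥ 1 - ε` and
`Pr(Z = 1) D(ρ_{C S₀' S₁' S̃}, ρ_C ⊗ ρ_{S₀' S₁' S̃}) ≤ ε`, all states being those of the runs that
do not abort. -/
def ReceiverSecure {Key Trap : Type} [Fintype Key] [Fintype Trap]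
    {n ℓ w m : ℕ} (P : Parameters Key Trap n ℓ w m) (ε : ℝ) : Prop :=
  ∀ (S B : Type) [Fintype S] [DecidableEq S] [Fintype B] [DecidableEq B]
    (𝒟 : Device S B Key w m) (𝒮 : DishonestSender S P),
    ∀ p ∈ stdSimplex ℝ Bool, 0 < probContinue 𝒟 𝒮 p →
    ∃ ρ : Bool → BitString ℓ → BitString ℓ × BitString ℓ → Matrix S S ℂ,
      (∀ c y s, (ρ c y s).PosSemidef) ∧
      (∀ c y, ∑ s, ρ c y s = realState 𝒟 𝒮 p c y) ∧
      1 - ε ≤ ∑ c, ∑ y, ∑ s : BitString ℓ × BitString ℓ,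
        (if y = (if c then s.2 else s.1) then (ρ c y s).trace.re else 0) ∧
      (let σ := cqState fun c => cqState fun s => ∑ y, ρ c y s
       probContinue 𝒟 𝒮 p * traceDist σ (traceRight σ ⊗ₖ traceLeft σ) ≤ ε)

/-- Perfect receiver-security. -/
def PerfectlyReceiverSecure {Key Trap : Type} [Fintype Key] [Fintype Trap]
    {n ℓ w m : ℕ} (P : Parameters Key Trap n ℓ w m) : Prop :=
  ReceiverSecure P 0

end ObliviousTransfer

open scoped Kronecker MatrixOrder ComplexOrder

namespace ObliviousTransfer

/-! ### Partial traces, instruments and measurements -/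

section PartialTrace

variable {S B : Type} [Fintype B]

/-! The choice bit enters only through the measurement basis of the choice rounds, those in `I`.
There the POVM acts on the receiver's fresh system alone and its outcome reaches only the receiver.
Summed over outcomes it is a partial trace in either basis (`Measurement.sum_applyRight`). The
receiver's message reveals the set `I` but no outcome of a round in `I` (`testMessage_erase`).

Hence the choice rounds may be evaluated as if each had been measured in the basis `x i` that the
sender announces later. This is `idealState`; it does not mention the choice bit, and both outputs
can be read off the same run, giving `S₀'` and `S₁'`. For a receiver with bit `c`, the rounds of
`Ĩ_c` are measured in the same basis in both pictures, while the outcomes of the other choice rounds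
influence neither `Y` nor the sender, so they can be summed out (`sum_finalStateOfBases_congr`).
Thus `(Y, S̃)` given `c` is distributed as `(S'_c, S̃)` in the ideal state
(`jointState_eq_sum_idealState`). Taking `C` independent of the ideal state and `Y = S'_C` gives the
required extension, with distance exactly zero. -/

theorem traceRight_add (ρ σ : Matrix (S × B) (S × B) ℂ) :
    traceRight (ρ + σ) = traceRight ρ + traceRight σ := by
  ext i j
  simp [traceRight, Finset.sum_add_distrib]

theorem posSemidef_traceRight {ρ : Matrix (S × B) (S × B) ℂ} (h : ρ.PosSemidef) :
    (traceRight ρ).PosSemidef := by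
  have : traceRight ρ = ∑ b, ρ.submatrix (fun i => (i, b)) (fun i => (i, b)) := by
    ext i j
    simp [traceRight, Matrix.sum_apply]
  rw [this]
  exact Matrix.posSemidef_sum _ fun b _ => h.submatrix _

/-- Partial cyclicity of the partial trace. -/
theorem traceRight_one_kronecker_mul_comm [Fintype S] [DecidableEq S]
    (A : Matrix B B ℂ) (ρ : Matrix (S × B) (S × B) ℂ) :
    traceRight (((1 : Matrix S S ℂ) ⊗ₖ A) * ρ) = traceRight (ρ * ((1 : Matrix S S ℂ) ⊗ₖ A)) := by
  ext i j
  simp only [traceRight, Matrix.of_apply, Matrix.mul_apply, Matrix.kroneckerMap_apply,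
    Fintype.sum_prod_type, Matrix.one_apply, ite_mul, mul_ite, one_mul, zero_mul, mul_zero]
  simp only [Finset.sum_comm (s := (Finset.univ : Finset S)), Finset.sum_ite_eq,
    Finset.sum_ite_eq', Finset.mem_univ, if_true]
  rw [Finset.sum_comm]
  simp only [mul_comm]

end PartialTrace

section Operations

variable {O S S' B : Type} [Fintype O] [Fintype S] [DecidableEq S] [Fintype S']
  [Fintype B] [DecidableEq B]

namespace Instrument

theorem apply_add (Φ : Instrument O S S') (o : O) (ρ σ : Matrix S S ℂ) :
    Φ.apply o (ρ + σ) = Φ.apply o ρ + Φ.apply o σ := by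
  simp [Instrument.apply, Matrix.mul_add, Matrix.add_mul, Finset.sum_add_distrib]

theorem applyLeft_add (Φ : Instrument O S S') (o : O) (ρ σ : Matrix (S × B) (S × B) ℂ) :
    Φ.applyLeft o (ρ + σ) = Φ.applyLeft o ρ + Φ.applyLeft o σ := by
  simp [Instrument.applyLeft, Matrix.mul_add, Matrix.add_mul, Finset.sum_add_distrib]

theorem posSemidef_apply (Φ : Instrument O S S') (o : O) {ρ : Matrix S S ℂ}
    (h : ρ.PosSemidef) : (Φ.apply o ρ).PosSemidef :=
  Matrix.posSemidef_sum _ fun _ _ => h.mul_mul_conjTranspose_same _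

theorem posSemidef_applyLeft (Φ : Instrument O S S') (o : O)
    {ρ : Matrix (S × B) (S × B) ℂ} (h : ρ.PosSemidef) : (Φ.applyLeft o ρ).PosSemidef :=
  Matrix.posSemidef_sum _ fun _ _ => h.mul_mul_conjTranspose_same _

end Instrument

namespace Measurement

theorem applyRight_add (M : Measurement O B) (o : O) (ρ σ : Matrix (S × B) (S × B) ℂ) :
    M.applyRight o (ρ + σ) = M.applyRight o ρ + M.applyRight o σ := by
  simp [Measurement.applyRight, Matrix.mul_add, traceRight_add]

/-- Writing the effect as `Aᴴ * A`, partial cyclicity turns the expression into the partial trace of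
the conjugation of `ρ` by `1 ⊗ A`. -/
theorem posSemidef_applyRight (M : Measurement O B) (o : O)
    {ρ : Matrix (S × B) (S × B) ℂ} (h : ρ.PosSemidef) : (M.applyRight o ρ).PosSemidef := by
  obtain ⟨A, hA⟩ := CStarAlgebra.nonneg_iff_eq_star_mul_self.mp (M.posSemidef o).nonneg
  have h1 : (1 : Matrix S S ℂ) ⊗ₖ M.effect o =
      ((1 : Matrix S S ℂ) ⊗ₖ A.conjTranspose) * ((1 : Matrix S S ℂ) ⊗ₖ A) := by
    rw [← Matrix.mul_kronecker_mul, hA, one_mul, Matrix.star_eq_conjTranspose]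
  have h2 : (1 : Matrix S S ℂ) ⊗ₖ A.conjTranspose = ((1 : Matrix S S ℂ) ⊗ₖ A).conjTranspose := by
    rw [Matrix.conjTranspose_kronecker, Matrix.conjTranspose_one]
  rw [Measurement.applyRight, h1, mul_assoc, traceRight_one_kronecker_mul_comm, h2]
  exact posSemidef_traceRight (h.mul_mul_conjTranspose_same _)

/-- Without the outcome, a measurement is a partial trace, whatever is measured. -/
theorem sum_applyRight (M : Measurement O B) (ρ : Matrix (S × B) (S × B) ℂ) :
    ∑ o, M.applyRight o ρ = traceRight ρ := by
  have h (o : O) : M.applyRight o ρ =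
      AddMonoidHom.mk' traceRight traceRight_add
        (((1 : Matrix S S ℂ) ⊗ₖ M.effect o) * ρ) := rfl
  have hk : ∑ o, (1 : Matrix S S ℂ) ⊗ₖ M.effect o = 1 := by
    rw [← Matrix.one_kronecker_one, ← M.complete]
    ext i j
    simp [Matrix.sum_apply, Matrix.kroneckerMap_apply, Finset.mul_sum]
  rw [Finset.sum_congr rfl fun o _ => h o, ← map_sum, ← Finset.sum_mul, hk, one_mul]
  rfl

end Measurement

end Operations

/-- A composition of sums of additive maps, expanded. -/
theorem sum_piFinset_foldl {M α : Type*} [AddCommMonoid M] :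
    ∀ {n : ℕ} (L : Fin n → α → M →+ M) (t : Fin n → Finset α) (x : M),
      ∑ r ∈ Fintype.piFinset t, Fin.foldl n (fun x i => L i (r i) x) x =
        Fin.foldl n (fun x i => ∑ a ∈ t i, L i a x) x
  | 0, L, t, x => by simp
  | n + 1, L, t, x => by
    classical
    -- The last map is outermost, so its additivity pulls out the sum over the earlier choices;
    -- `Fin.snoc` then glues the two index sets together.
    simp only [Fin.foldl_succ_last]
    rw [← sum_piFinset_foldl (fun i => L i.castSucc) (fun i => t i.castSucc) x]
    simp only [map_sum]
    rw [← Finset.sum_product']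
    refine Finset.sum_bij' (fun r _ => (r (Fin.last n), fun i => r i.castSucc))
      (fun p _ => Fin.snoc (α := fun _ => α) p.2 p.1) ?_ ?_ ?_ ?_ ?_
    · intro r hr
      simp only [Fintype.mem_piFinset, Finset.mem_product] at hr ⊢
      exact ⟨hr _, fun i => hr _⟩
    · intro p hp
      simp only [Fintype.mem_piFinset, Finset.mem_product] at hp ⊢
      intro i
      refine Fin.lastCases ?_ (fun i => ?_) i
      · simpa using hp.1
      · simpa using hp.2 i
    · intro r _
      exact Fin.snoc_init_self (α := fun _ => α) r
    · intro p _
      simp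
    · intro r _
      rfl

/-! ### Erasing the outcomes that do not matter -/

section Erase

variable {Key Trap : Type} {n ℓ w m : ℕ} {P : Parameters Key Trap n ℓ w m}

/-- Erase the outcome of the final measurement, if `b` holds and the round is a choice round. -/
def RoundRecord.erase (b : Bool) (r : RoundRecord Key w m) : RoundRecord Key w m :=
  match b, r with
  | true, ⟨k, x, .b d q true _ _⟩ => ⟨k, x, .b d q true false false⟩
  | _, r => r

theorem RoundRecord.usesChoice_erase (b : Bool) (r : RoundRecord Key w m) :
    (r.erase b).response.usesChoice = r.response.usesChoice := by
  obtain ⟨k, x, z | ⟨d, q, _ | _, ans, h⟩⟩ := r <;> cases b <;> rfl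

theorem RoundRecord.erase_of_not_usesChoice (b : Bool) {r : RoundRecord Key w m}
    (hr : r.response.usesChoice ≠ true) : r.erase b = r := by
  obtain ⟨k, x, z | ⟨d, q, _ | _, ans, h⟩⟩ := r <;> cases b <;>
    first | rfl | exact absurd rfl hr

theorem choiceRounds_erase (b : Fin n → Bool) (r : Fin n → RoundRecord Key w m) :
    choiceRounds (fun i => (r i).erase (b i)) = choiceRounds r := by
  simp only [choiceRounds, RoundRecord.usesChoice_erase]

/-- Outputs are published only for rounds outside `I`, where erasing does nothing, and `I` is read
off the coins. So the sender's later operations cannot depend on the erased outcomes. -/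
theorem testMessage_erase (b : Fin n → Bool) (r : Fin n → RoundRecord Key w m)
    (use : Fin n → RoundUse) :
    testMessage (fun i => (r i).erase (b i)) use = testMessage r use := by
  simp only [testMessage, choiceRounds_erase]
  congr 1
  funext i
  by_cases hi : i ∈ choiceRounds r
  · simp [hi]
  · rw [RoundRecord.erase_of_not_usesChoice (b i) (r := r i) (by simpa [choiceRounds] using hi)]

theorem restrictPad_congr {s s' : BitString n} {J : Finset (Fin n)} (h : ∀ i ∈ J, s i = s' i) :
    restrictPad s J = restrictPad s' J := by
  funext j
  unfold restrictPad
  split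
  · exact h _ (Finset.orderEmbOfFin_mem _ _ _)
  · rfl

/-- The output of the receiver with choice bit `c` does not depend on the outcomes of the choice
rounds outside `Ĩ_c`. -/
theorem receiverOutput_erase (c : Bool) (r : Fin n → RoundRecord Key w m)
    (use : Fin n → RoundUse) (trap : Fin n → Trap) (f₀ f₁ : P.hash) (x : Fin n → Basis)
    (b : Fin n → Bool) (hb : ∀ i, use i = .generate → x i = Basis.ofBit c → b i = false) :
    Transcript.receiverOutput ⟨fun i => (r i).erase (b i), use, trap, f₀, f₁, x⟩ c =
      Transcript.receiverOutput ⟨r, use, trap, f₀, f₁, x⟩ c := by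
  unfold Transcript.receiverOutput
  have hJ : Transcript.outputRounds ⟨fun i => (r i).erase (b i), use, trap, f₀, f₁, x⟩ c =
      Transcript.outputRounds ⟨r, use, trap, f₀, f₁, x⟩ c := by
    simp only [Transcript.outputRounds, choiceRounds_erase]
  rw [hJ]
  refine congrArg (if c then f₁ else f₀).1 (restrictPad_congr fun i hi => ?_)
  obtain ⟨-, h1, h2⟩ := Finset.mem_filter.mp hi
  have : (r i).erase (b i) = r i := by rw [hb i h1 h2]; rfl
  simp only [Transcript.correction, Transcript.bellBit, this]

end Erase

/-! ### Runs in which the choice rounds are measured in prescribed bases -/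

section Experiment

variable {Key Trap : Type} [Fintype Key] [Fintype Trap] {n ℓ w m : ℕ} {S B : Type}
  [Fintype S] [DecidableEq S] [Fintype B] [DecidableEq B] {P : Parameters Key Trap n ℓ w m}
  (𝒟 : Device S B Key w m) (𝒮 : DishonestSender S P)

/-- One round in which the component measures in the basis `β` if the coin `useChoice` says so. -/
noncomputable def roundStateOfBasis (β : Basis) (i : Fin n) (r : RoundRecord Key w m)
    (ρ : Matrix S S ℂ) : Matrix S S ℂ :=
  let ρ₁ := (𝒟.commit r.key).apply r.commitment ((𝒮.sendKey i).apply r.key ρ)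
  match r.response with
  | .a z => traceRight (𝒟.answerA.apply z ((𝒮.sendChallenge i).applyLeft .a ρ₁))
  | .b d question useChoice ans h =>
    let ρ₂ := 𝒟.answerB.apply d ((𝒮.sendChallenge i).applyLeft .b ρ₁)
    let ρ₃ := (𝒮.sendQuestion i).applyLeft question ρ₂
    (1 / 2 : ℂ) • (𝒟.measure (if useChoice then β else question)).applyRight (ans, h) ρ₃

/-- Additivity lets a sum over the outcomes of one round pass through all later rounds. -/
theorem roundStateOfBasis_add (β : Basis) (i : Fin n) (r : RoundRecord Key w m)
    (ρ σ : Matrix S S ℂ) : roundStateOfBasis 𝒟 𝒮 β i r (ρ + σ) =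
      roundStateOfBasis 𝒟 𝒮 β i r ρ + roundStateOfBasis 𝒟 𝒮 β i r σ := by
  obtain ⟨k, x, z | ⟨d, q, u, ans, h⟩⟩ := r
  · simp only [roundStateOfBasis, Instrument.apply_add, Instrument.applyLeft_add, traceRight_add]
  · simp only [roundStateOfBasis, Instrument.apply_add, Instrument.applyLeft_add,
      Measurement.applyRight_add, smul_add]

theorem posSemidef_roundStateOfBasis (β : Basis) (i : Fin n) (r : RoundRecord Key w m)
    {ρ : Matrix S S ℂ} (hρ : ρ.PosSemidef) : (roundStateOfBasis 𝒟 𝒮 β i r ρ).PosSemidef := by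
  have h₁ := (𝒟.commit r.key).posSemidef_apply r.commitment
    ((𝒮.sendKey i).posSemidef_apply r.key hρ)
  obtain ⟨k, x, z | ⟨d, q, u, ans, h⟩⟩ := r
  · exact posSemidef_traceRight
      (𝒟.answerA.posSemidef_apply z ((𝒮.sendChallenge i).posSemidef_applyLeft .a h₁))
  · refine Matrix.PosSemidef.smul (Measurement.posSemidef_applyRight _ _
      ((𝒮.sendQuestion i).posSemidef_applyLeft q
        (𝒟.answerB.posSemidef_apply d ((𝒮.sendChallenge i).posSemidef_applyLeft .b h₁)))) ?_
    rw [one_div, ← Complex.ofReal_ofNat, ← Complex.ofReal_inv]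
    exact Complex.zero_le_real.mpr (by norm_num)

/-- The sender's operations after the last round, as an additive map. -/
noncomputable def conclude (msg : TestMessage n w m) (use : Fin n → RoundUse)
    (trap : Fin n → Trap) (a : P.hash × P.hash × (Fin n → Basis)) :
    Matrix S S ℂ →+ Matrix S S ℂ :=
  AddMonoidHom.mk' (fun ρ => 𝒮.announce.apply a (𝒮.sendTrapdoors.apply trap
    ((𝒮.decide msg).apply true (𝒮.sendUses.apply use ρ))))
    fun ρ σ => by simp only [Instrument.apply_add]

/-- The final state for the transcript `tr`, if the component measures in the basis `θ i` in every
choice round `i`. -/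
noncomputable def finalStateOfBases (θ : Fin n → Basis) (tr : Transcript Key Trap P.hash n w m) :
    Matrix S S ℂ :=
  conclude 𝒮 (testMessage tr.round tr.use) tr.use tr.trapdoor (tr.hash₀, tr.hash₁, tr.bases)
    (Fin.foldl n (fun ρ i => roundStateOfBasis 𝒟 𝒮 (θ i) i (tr.round i) ρ) 𝒮.init)

theorem finalState_eq_finalStateOfBases (c : Bool) (tr : Transcript Key Trap P.hash n w m) :
    finalState 𝒟 𝒮 c tr = finalStateOfBases 𝒟 𝒮 (fun _ => Basis.ofBit c) tr := rfl

/-- The map `e` keeps the original round numbers while the induction removes rounds from the front;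
the intended case is `e = id`. -/
theorem posSemidef_foldl_roundStateOfBasis :
    ∀ {k : ℕ} (e : Fin k → Fin n) (θ : Fin k → Basis) (r : Fin k → RoundRecord Key w m)
      {ρ : Matrix S S ℂ}, ρ.PosSemidef →
      (Fin.foldl k (fun ρ i => roundStateOfBasis 𝒟 𝒮 (θ i) (e i) (r i) ρ) ρ).PosSemidef
  | 0, _, _, _, _, h => by simpa using h
  | k + 1, e, θ, r, _, h => by
    rw [Fin.foldl_succ]
    exact posSemidef_foldl_roundStateOfBasis (fun i => e i.succ) (fun i => θ i.succ)
      (fun i => r i.succ) (posSemidef_roundStateOfBasis 𝒟 𝒮 _ _ _ h)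

theorem posSemidef_finalStateOfBases (θ : Fin n → Basis)
    (tr : Transcript Key Trap P.hash n w m) : (finalStateOfBases 𝒟 𝒮 θ tr).PosSemidef :=
  Instrument.posSemidef_apply _ _ (Instrument.posSemidef_apply _ _ (Instrument.posSemidef_apply _ _
    (Instrument.posSemidef_apply _ _
      (posSemidef_foldl_roundStateOfBasis 𝒟 𝒮 id θ tr.round 𝒮.init_posSemidef))))

open Classical in
/-- If the outcome of a choice round is forgotten, its basis does not matter. -/
theorem sum_roundStateOfBasis_erase (i : Fin n) (b : Bool) (β β' : Basis)
    (hβ : b = false → β = β') (r₀ : RoundRecord Key w m) (ρ : Matrix S S ℂ) :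
    ∑ r with RoundRecord.erase b r = r₀, roundStateOfBasis 𝒟 𝒮 β i r ρ =
      ∑ r with RoundRecord.erase b r = r₀, roundStateOfBasis 𝒟 𝒮 β' i r ρ := by
  cases b with
  | false => rw [hβ rfl]
  | true =>
    by_cases hr : ∃ k x d q, r₀ = ⟨k, x, .b d q true false false⟩
    · obtain ⟨k, x, d, q, rfl⟩ := hr
      let e : Bool × Bool → RoundRecord Key w m := fun o => ⟨k, x, .b d q true o.1 o.2⟩
      have he : Function.Injective e := by
        rintro ⟨a, h⟩ ⟨a', h'⟩ hh
        simpa [e] using hh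
      -- The fibre over an erased choice record consists of the four outcomes `(b, h)`, so the sum
      -- over it is half the partial trace, in which no basis occurs.
      have hf : (Finset.univ.filter fun r : RoundRecord Key w m =>
          RoundRecord.erase true r = ⟨k, x, .b d q true false false⟩) =
          Finset.univ.map ⟨e, he⟩ := by
        ext r
        obtain ⟨k', x', z | ⟨d', q', _ | _, ans, h⟩⟩ := r <;>
          simp [RoundRecord.erase, e, eq_comm]
      simp only [hf, Finset.sum_map, Function.Embedding.coeFn_mk, e, roundStateOfBasis, if_true,
        ← Finset.smul_sum, Prod.mk.eta, Measurement.sum_applyRight]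
    -- Otherwise the fibre contains no choice round, and the prescribed basis is never consulted.
    · refine Finset.sum_congr rfl fun r hr' => ?_
      have h' := (Finset.mem_filter.mp hr').2
      obtain ⟨k, x, z | ⟨d, q, _ | _, ans, h⟩⟩ := r
      · rfl
      · rfl
      · exact absurd ⟨k, x, d, q, h'.symm⟩ hr

/-- The joint state of the receiver's output and the sender depends only on the bases used in the
rounds from which the output is generated. -/
theorem sum_finalStateOfBases_congr (c : Bool) (y : BitString ℓ)
    (θ θ' : (Fin n → Basis) → Fin n → Basis)
    (hθ : ∀ x i, x i = Basis.ofBit c → θ x i = θ' x i) :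
    (∑ tr : Transcript Key Trap P.hash n w m,
      if tr.receiverOutput c = y then finalStateOfBases 𝒟 𝒮 (θ tr.bases) tr else 0) =
    ∑ tr : Transcript Key Trap P.hash n w m,
      if tr.receiverOutput c = y then finalStateOfBases 𝒟 𝒮 (θ' tr.bases) tr else 0 := by
  classical
  rw [← (Transcript.equiv Key Trap P.hash n w m).symm.sum_comp,
    ← (Transcript.equiv Key Trap P.hash n w m).symm.sum_comp]
  -- Fix all announcements first. With `x` fixed, the bases `θ x` are constants, although the sender
  -- announces `x` only after the measurements.
  refine (Fintype.sum_prod_type_right _).trans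
    (Eq.trans ?_ (Fintype.sum_prod_type_right _).symm)
  refine Finset.sum_congr rfl ?_
  rintro ⟨use, trap, f₀, f₁, x⟩ -
  -- `b` marks the rounds that cannot lie in `Ĩ_c`; their outcomes, if they are choice rounds, may
  -- be forgotten.
  let b : Fin n → Bool := fun i => !decide (use i = .generate ∧ x i = Basis.ofBit c)
  have hb : ∀ i, use i = .generate → x i = Basis.ofBit c → b i = false := fun i h1 h2 => by
    simp [b, h1, h2]
  let E : (Fin n → RoundRecord Key w m) → Fin n → RoundRecord Key w m :=
    fun r i => (r i).erase (b i)
  -- Group the runs by what remains after erasing. The output and the test message are constant on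
  -- each fibre.
  refine (Finset.sum_fiberwise Finset.univ E _).symm.trans
    (Eq.trans ?_ (Finset.sum_fiberwise Finset.univ E _))
  refine Finset.sum_congr rfl fun r₀ _ => ?_
  -- Erasing acts round by round, so a fibre is a product set and the sum over it becomes a
  -- composition of one-round sums.
  have hfib : (Finset.univ.filter fun r => E r = r₀) =
      Fintype.piFinset fun i => Finset.univ.filter fun r => RoundRecord.erase (b i) r = r₀ i := by
    ext r
    simp [E, funext_iff]
  have key (η : Fin n → Basis) :
      (∑ r with E r = r₀, if Transcript.receiverOutput ⟨r, use, trap, f₀, f₁, x⟩ c = y then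
        finalStateOfBases 𝒟 𝒮 η ⟨r, use, trap, f₀, f₁, x⟩ else 0) =
      if Transcript.receiverOutput ⟨r₀, use, trap, f₀, f₁, x⟩ c = y then
        conclude 𝒮 (testMessage r₀ use) use trap (f₀, f₁, x)
          (Fin.foldl n (fun ρ i => ∑ r with RoundRecord.erase (b i) r = r₀ i,
            roundStateOfBasis 𝒟 𝒮 (η i) i r ρ) 𝒮.init) else 0 := by
    have h1 : ∀ r ∈ Finset.univ.filter (fun r => E r = r₀),
        (if Transcript.receiverOutput ⟨r, use, trap, f₀, f₁, x⟩ c = y then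
          finalStateOfBases 𝒟 𝒮 η ⟨r, use, trap, f₀, f₁, x⟩ else 0) =
        if Transcript.receiverOutput ⟨r₀, use, trap, f₀, f₁, x⟩ c = y then
          conclude 𝒮 (testMessage r₀ use) use trap (f₀, f₁, x)
            (Fin.foldl n (fun ρ i => roundStateOfBasis 𝒟 𝒮 (η i) i (r i) ρ) 𝒮.init) else 0 := by
      intro r hr
      obtain rfl := (Finset.mem_filter.mp hr).2
      simp only [E, receiverOutput_erase c r use trap f₀ f₁ x b hb, testMessage_erase]
      rfl
    rw [Finset.sum_congr rfl h1]
    split_ifs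
    · rw [← map_sum, hfib]
      congr 1
      exact sum_piFinset_foldl (fun i r => AddMonoidHom.mk' (roundStateOfBasis 𝒟 𝒮 (η i) i r)
        (roundStateOfBasis_add 𝒟 𝒮 (η i) i r)) _ _
    · simp
  refine (key (θ x)).trans (Eq.trans ?_ (key (θ' x)).symm)
  have : (fun (ρ : Matrix S S ℂ) i => ∑ r with RoundRecord.erase (b i) r = r₀ i,
        roundStateOfBasis 𝒟 𝒮 (θ x i) i r ρ) =
      fun ρ i => ∑ r with RoundRecord.erase (b i) r = r₀ i,
        roundStateOfBasis 𝒟 𝒮 (θ' x i) i r ρ := by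
    funext ρ i
    refine sum_roundStateOfBasis_erase 𝒟 𝒮 i (b i) _ _ (fun h => hθ x i ?_) _ _
    simp only [b, Bool.not_eq_false', decide_eq_true_eq] at h
    exact h.2
  rw [this]

/-! ### The ideal state -/

/-- The unnormalized joint state of the strings `S₀'`, `S₁'` and the sender, restricted to the
event that the protocol does not abort: in every choice round the component measures in the basis
that the sender is going to announce. -/
noncomputable def idealState (s : BitString ℓ × BitString ℓ) : Matrix S S ℂ :=
  ∑ tr : Transcript Key Trap P.hash n w m,
    if tr.receiverOutput false = s.1 ∧ tr.receiverOutput true = s.2 then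
      finalStateOfBases 𝒟 𝒮 tr.bases tr else 0

theorem posSemidef_idealState (s : BitString ℓ × BitString ℓ) :
    (idealState 𝒟 𝒮 s).PosSemidef := by
  refine Matrix.posSemidef_sum _ fun tr _ => ?_
  split_ifs
  · exact posSemidef_finalStateOfBases 𝒟 𝒮 _ tr
  · exact Matrix.PosSemidef.zero

/-- With choice bit `c`, the real state of `Y` and the sender is the ideal one of `S_c'` and the
sender. -/
theorem jointState_eq_sum_idealState (p : Bool → ℝ) (c : Bool) (y : BitString ℓ) :
    jointState 𝒟 𝒮 p c y =
      (p c : ℂ) • ∑ s : BitString ℓ × BitString ℓ,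
        if y = (if c then s.2 else s.1) then idealState 𝒟 𝒮 s else 0 := by
  unfold jointState
  congr 1
  simp only [finalState_eq_finalStateOfBases]
  -- Replace the receiver's constant basis by the announced ones: they agree wherever `x i =
  -- Basis.ofBit c`.
  rw [sum_finalStateOfBases_congr 𝒟 𝒮 c y (fun _ _ => Basis.ofBit c) (fun x => x)
    fun x i h => h.symm]
  -- Each transcript contributes to exactly one pair `s`, its own two outputs, so after exchanging
  -- the sums the sum over `s` collapses.
  have h (s : BitString ℓ × BitString ℓ) :
      (if y = (if c then s.2 else s.1) then idealState 𝒟 𝒮 s else 0) =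
      ∑ tr : Transcript Key Trap P.hash n w m,
        if s = (tr.receiverOutput false, tr.receiverOutput true) then
          (if tr.receiverOutput c = y then finalStateOfBases 𝒟 𝒮 tr.bases tr else 0) else 0 := by
    obtain ⟨s₀, s₁⟩ := s
    have hz : (if y = (if c then s₁ else s₀) then idealState 𝒟 𝒮 (s₀, s₁) else 0) =
        ∑ tr : Transcript Key Trap P.hash n w m, if y = (if c then s₁ else s₀) then
          (if tr.receiverOutput false = s₀ ∧ tr.receiverOutput true = s₁ then
            finalStateOfBases 𝒟 𝒮 tr.bases tr else 0) else 0 := by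
      by_cases hy : y = (if c then s₁ else s₀)
      · simp only [if_pos hy]
        rfl
      · simp only [if_neg hy, Finset.sum_const_zero]
    rw [hz]
    refine Finset.sum_congr rfl fun tr _ => ?_
    by_cases h : tr.receiverOutput false = s₀ ∧ tr.receiverOutput true = s₁
    · obtain ⟨rfl, rfl⟩ := h
      cases c <;> simp [eq_comm]
    · have h' : (s₀, s₁) ≠ (tr.receiverOutput false, tr.receiverOutput true) := fun h' =>
        h ⟨(congrArg Prod.fst h').symm, (congrArg Prod.snd h').symm⟩
      rw [if_neg h, if_neg h', ite_self]
  simp only [h]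
  rw [Finset.sum_comm]
  simp

end Experiment

/-! ### Product states -/

/-- A conditional state that depends on `x` only through a scalar weight is uncorrelated with the
classical register; this splits off `C` in the main theorem. -/
theorem cqState_smul {X S : Type} [Fintype X] [DecidableEq X] (p : X → ℂ) (τ : Matrix S S ℂ) :
    cqState (fun x => p x • τ) = Matrix.diagonal p ⊗ₖ τ := by
  ext ⟨x, i⟩ ⟨x', j⟩
  simp only [cqState, Matrix.sum_apply, Matrix.kroneckerMap_apply, Matrix.smul_apply,
    Matrix.single_apply, Matrix.diagonal_apply, smul_eq_mul, ite_mul, one_mul, zero_mul]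
  by_cases h : x = x'
  · subst h
    simp
  · simp only [h, if_false]
    refine Finset.sum_eq_zero fun a _ => if_neg ?_
    rintro ⟨rfl, rfl⟩
    exact h rfl

theorem traceRight_kronecker {X S : Type} [Fintype S] (A : Matrix X X ℂ) (τ : Matrix S S ℂ) :
    traceRight (A ⊗ₖ τ) = τ.trace • A := by
  ext i j
  simp [traceRight, Matrix.trace, ← Finset.mul_sum, mul_comm]

theorem traceLeft_kronecker {X S : Type} [Fintype X] (A : Matrix X X ℂ) (τ : Matrix S S ℂ) :
    traceLeft (A ⊗ₖ τ) = A.trace • τ := by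
  ext i j
  simp [traceLeft, Matrix.trace, ← Finset.sum_mul]

theorem trace_cqState {X S : Type} [Fintype X] [DecidableEq X] [Fintype S]
    (ρ : X → Matrix S S ℂ) : (cqState ρ).trace = ∑ x, (ρ x).trace := by
  simp [cqState, Matrix.trace_sum, Matrix.trace_kronecker]

theorem traceDist_self {S : Type} [Fintype S] [DecidableEq S] (ρ : Matrix S S ℂ) :
    traceDist ρ ρ = 0 := by
  simp [traceDist]

end ObliviousTransfer

theorem mainTheorem2 {Key Trap : Type} [Fintype Key] [Fintype Trap]
    {n ℓ w m : ℕ} (P : ObliviousTransfer.Parameters Key Trap n ℓ w m) :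
    ObliviousTransfer.PerfectlyReceiverSecure P := by
  open ObliviousTransfer in
  intro S B _ _ _ _ 𝒟 𝒮 p hp hP
  have hp0 : ∀ c, (0 : ℂ) ≤ p c := fun c => Complex.zero_le_real.mpr (hp.1 c)
  have hp1 : ∑ c, (p c : ℂ) = 1 := by exact_mod_cast hp.2
  set q : ℝ := probContinue 𝒟 𝒮 p with hq
  let τ : BitString ℓ × BitString ℓ → Matrix S S ℂ := fun s => (q⁻¹ : ℂ) • idealState 𝒟 𝒮 s
  have hτ : ∀ s, (τ s).PosSemidef := fun s => by
    refine (posSemidef_idealState 𝒟 𝒮 s).smul ?_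
    rw [← Complex.ofReal_inv]
    exact Complex.zero_le_real.mpr (inv_nonneg.mpr hP.le)
  -- Draw `C` independently of `τ` and set `Y = S'_C`.
  let ρ : Bool → BitString ℓ → BitString ℓ × BitString ℓ → Matrix S S ℂ :=
    fun c y s => if y = (if c then s.2 else s.1) then (p c : ℂ) • τ s else 0
  have hreal : ∀ c y, ∑ s, ρ c y s = realState 𝒟 𝒮 p c y := fun c y => by
    simp only [ρ, τ, realState, jointState_eq_sum_idealState, Finset.smul_sum, smul_ite, smul_zero]
    simp only [smul_comm (p c : ℂ), ← hq]
  have hsum : ∀ c s, ∑ y, ρ c y s = (p c : ℂ) • τ s := fun c s => by simp [ρ]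
  have hone : ∑ c, ∑ y, (realState 𝒟 𝒮 p c y).trace.re = 1 := by
    have (c : Bool) (y : BitString ℓ) : (realState 𝒟 𝒮 p c y).trace.re =
        q⁻¹ * (jointState 𝒟 𝒮 p c y).trace.re := by
      rw [realState, Matrix.trace_smul, ← Complex.ofReal_inv, smul_eq_mul, Complex.re_ofReal_mul]
    simp only [this, ← Finset.mul_sum]
    exact inv_mul_cancel₀ hP.ne'
  -- The normalization of `τ` is inherited from the real state: summing the extension over `c` and
  -- `y` leaves the trace of `τ` times the total weight of `p`, which is one.
  have htrre : (∑ s, (τ s).trace).re = 1 := by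
    rw [← hone]
    simp only [← hreal, Matrix.trace_sum, Complex.re_sum]
    have (c : Bool) : ∑ y, ∑ s, (ρ c y s).trace.re = p c * ∑ s, (τ s).trace.re := by
      rw [Finset.sum_comm, Finset.mul_sum]
      refine Finset.sum_congr rfl fun s _ => ?_
      rw [← Complex.re_sum, ← Matrix.trace_sum, hsum, Matrix.trace_smul, smul_eq_mul,
        Complex.re_ofReal_mul]
    simp only [this, ← Finset.sum_mul, hp.2, one_mul]
  have htr : ∑ s, (τ s).trace = 1 := by
    refine Complex.ext htrre ?_
    rw [Complex.im_sum]
    exact Finset.sum_eq_zero fun s _ => ((Complex.nonneg_iff.mp (hτ s).trace_nonneg).2).symm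
  refine ⟨ρ, fun c y s => ?_, hreal, ?_, ?_⟩
  · by_cases hy : y = (if c then s.2 else s.1)
    · simp only [ρ, if_pos hy]
      exact (hτ s).smul (hp0 c)
    · simp only [ρ, if_neg hy]
      exact Matrix.PosSemidef.zero
  · have (c : Bool) (y : BitString ℓ) : (∑ s : BitString ℓ × BitString ℓ,
        if y = (if c then s.2 else s.1) then (ρ c y s).trace.re else 0) =
        (realState 𝒟 𝒮 p c y).trace.re := by
      rw [← hreal, Matrix.trace_sum, Complex.re_sum]
      refine Finset.sum_congr rfl fun s _ => ?_
      by_cases hy : y = (if c then s.2 else s.1) <;> simp [ρ, hy]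
    simp only [this, hone, sub_zero, le_refl]
  -- Forgetting `Y` leaves the product of the distribution of `C` with `τ`. Both factors have trace
  -- one, so this state equals the product of its marginals.
  · have hσ : (cqState fun c => cqState fun s => ∑ y, ρ c y s) =
        Matrix.diagonal (fun c => (p c : ℂ)) ⊗ₖ cqState τ := by
      rw [← cqState_smul]
      refine congrArg cqState (funext fun c => ?_)
      simp only [hsum, cqState, Matrix.kronecker_smul, Finset.smul_sum]
    intro σ
    have : traceRight σ ⊗ₖ traceLeft σ = σ := by
      simp only [σ]
      rw [hσ, traceRight_kronecker, traceLeft_kronecker, trace_cqState, htr,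
        Matrix.trace_diagonal, hp1, one_smul, one_smul]
    rw [this, traceDist_self, mul_zero]
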